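/- For $f:\{0,1\}^n\to\mathbb{R}$ and $S\subseteq[n]$ let $\chi_S(x)=(-1)^{\sum_{i\in S}x_i}$ and $\hat f(S)=\mathbb{E}_x[f(x)\chi_S(x)]$, where $x$ is uniform on $\{0,1\}^n$; let $W^{>d}(f)=\sum_{|S|>d}\hat f(S)^2$ and $\|f\|_2=(\mathbb{E}_x[f(x)^2])^{1/2}$. Let $\deg^{\ell_2}_\varepsilon(f)$ be the smallest $d$ for which there is a real polynomial $p$ of degree at most $d$ with $\|f-p\|_2\le\varepsilon$. For $1\le k\le n$ let $$\mathsf{hs}_k(x)=\min\Big\{1,\ \tfrac{2}{k}\sum_{i=1}^k x_i\Big\},\qquad x\in\{0,1\}^n .$$ 1. There is an absolute constant $c>0$ such that for all integers $n,k,d$ with $k\le n$ and $1\le d\le k/2$, $$W^{>d}(\mathsf{hs}_k)\ \ge\ c\cdot\frac{d^{-3/2}}{k}.$$ 2. There are absolute constants $c_1,c_2>0$ such that for every real $\varepsilon>0$ for which $k=\lfloor c_1\varepsilon^{-4/5}\rfloor$ is at least $1$ (that is, for every $0<\varepsilon\le c_1^{5/4}$) and for every $n\ge k$, $$W^{>\lfloor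 k/2\rfloor}(\mathsf{hs}_k)\ \ge\ \varepsilon^2\qquad\text{and}\qquad \deg^{\ell_2}_\varepsilon(\mathsf{hs}_k)\ \ge\ c_2\,\varepsilon^{-4/5}.$$ 3. For all $1\le k\le n$ the function $\mathsf{hs}_k$ takes values in $[0,1]$, is monotone (coordinatewise non-decreasing), is submodular ($f(x\vee y)+f(x\wedge y)\le f(x)+f(y)$ for all $x,y$), and is symmetric in its $k$ variables: it is invariant under every permutation of the $n$ coordinates that maps the first $k$ coordinates to themselves. -/

import Mathlib

/-- The parity function `χ_S(x) = (-1)^{∑_{i ∈ S} x_i}` on the cube `{0,1}^n`. -/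
def parity {n : ℕ} (S : Finset (Fin n)) (x : Fin n → Bool) : ℝ :=
  (-1) ^ (∑ i ∈ S, (x i).toNat)

/-- The expectation of `f` under the uniform distribution on `{0,1}^n`. -/
noncomputable def cubeMean {n : ℕ} (f : (Fin n → Bool) → ℝ) : ℝ :=
  (∑ x, f x) / 2 ^ n

/-- The Fourier coefficient `f̂(S) = 𝔼[f χ_S]`. -/
noncomputable def cubeFourierCoeff {n : ℕ} (f : (Fin n → Bool) → ℝ) (S : Finset (Fin n)) : ℝ :=
  cubeMean fun x => f x * parity S x

/-- The Fourier weight `W^j(f) = ∑_{|S| = j} f̂(S)^2` at level `j`. -/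
noncomputable def fourierWeight {n : ℕ} (f : (Fin n → Bool) → ℝ) (j : ℕ) : ℝ :=
  ∑ S ∈ Finset.powersetCard j (Finset.univ : Finset (Fin n)), cubeFourierCoeff f S ^ 2

/-- The Fourier weight `W^{>d}(f) = ∑_{j > d} W^j(f)` above level `d`
(there are no sets of size larger than `n`). -/
noncomputable def fourierWeightAbove {n : ℕ} (f : (Fin n → Bool) → ℝ) (d : ℕ) : ℝ :=
  ∑ j ∈ Finset.Ioc d n, fourierWeight f j

/-- The `ℓ₂` norm `‖f‖₂ = (𝔼[f^2])^{1/2}` over the uniform distribution. -/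
noncomputable def cubeL2Norm {n : ℕ} (f : (Fin n → Bool) → ℝ) : ℝ :=
  Real.sqrt (cubeMean fun x => f x ^ 2)

/-- The value at a point of `{0,1}^n` of a real polynomial in `n` variables. -/
noncomputable def evalCube {n : ℕ} (p : MvPolynomial (Fin n) ℝ) (x : Fin n → Bool) : ℝ :=
  MvPolynomial.eval (fun i => ((x i).toNat : ℝ)) p

/-- The `(ℓ₂, ε)`-approximate degree of `f`: the smallest `d` such that some real polynomial `p` of
degree at most `d` satisfies `‖f - p‖₂ ≤ ε`. For `ε ≥ 0` such a `d` exists, as every function on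
the cube is a polynomial. -/
noncomputable def approxDegree {n : ℕ} (ε : ℝ) (f : (Fin n → Bool) → ℝ) : ℕ :=
  sInf {d : ℕ | ∃ p : MvPolynomial (Fin n) ℝ,
    p.totalDegree ≤ d ∧ cubeL2Norm (fun x => f x - evalCube p x) ≤ ε}

/-- Submodularity; on `{0,1}^n` the join and meet are the union and intersection of sets. -/
def Submodular {n : ℕ} (f : (Fin n → Bool) → ℝ) : Prop :=
  ∀ x y, f (x ⊔ y) + f (x ⊓ y) ≤ f x + f y

/-- The Hamming weight `w_k(x)` of the first `k` bits of `x`. -/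
def prefixWeight {n : ℕ} (k : ℕ) (x : Fin n → Bool) : ℕ :=
  ∑ i with i.val < k, (x i).toNat

/-- The hockey-stick function `hs_k(x) = min {1, 2 w_k(x) / k}` on `{0,1}^n`. -/
noncomputable def hockeyStick (n k : ℕ) (x : Fin n → Bool) : ℝ :=
  min 1 (2 * (prefixWeight k x : ℝ) / k)

open Finset Polynomial
open scoped Nat fwdDiff

/-!
By Parseval, no polynomial of degree at most `d` approximates `f` in `ℓ₂` better than
`W^{>d}(f)^{1/2}`, so both lower bounds rest on the Fourier coefficients of `hs_k`. If `f` is a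
symmetric function of `k` bits with value `g w` at Hamming weight `w`, then `f̂(S)` with `|S| = j`
is, up to the factor `2^{-k}`, the pairing of `g` with the coefficients of
`(1 - X)^j (1 + X)^{k-j}`. A factor `(1 - X)^2` can be moved onto `g` as a second difference, and
for the hockey stick this is concentrated at the kink `w ≈ k / 2`. For `j = 2r + 2` the Fourier
coefficient is therefore a middle coefficient of `(1 - X)^{2r} (1 + X)^{2s}`, which by von Szily's
identity is a super Catalan number up to sign. Bounds on central binomial coefficients then give
weight of order `(r + 1)^{-5/2} / k` at level `2r + 2`, and the order of `d` such levels just above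
`d` contribute `d^{-3/2} / k` in total.
-/

section Fourier

variable {n d : ℕ} {f : (Fin n → Bool) → ℝ} {ε : ℝ}

theorem parity_eq_prod (S : Finset (Fin n)) (x : Fin n → Bool) :
    parity S x = ∏ i, if i ∈ S then (-1 : ℝ) ^ (x i).toNat else 1 := by
  rw [prod_ite_mem, univ_inter, prod_pow_eq_pow_sum, parity]

theorem parity_mul_parity_eq_prod (S : Finset (Fin n)) (x y : Fin n → Bool) :
    parity S x * parity S y = ∏ i ∈ S, if x i = y i then (1 : ℝ) else -1 := by
  simp only [parity, ← prod_pow_eq_pow_sum, ← prod_mul_distrib]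
  refine prod_congr rfl fun i _ => ?_
  cases x i <;> cases y i <;> norm_num

theorem sum_parity_mul_parity (x y : Fin n → Bool) :
    ∑ S, parity S x * parity S y = if x = y then (2 : ℝ) ^ n else 0 := by
  simp_rw [parity_mul_parity_eq_prod]
  rw [← powerset_univ, ← prod_one_add]
  split_ifs with hxy
  · subst hxy
    norm_num
  · obtain ⟨i, hi⟩ := Function.ne_iff.mp hxy
    exact prod_eq_zero (mem_univ i) (by simp [hi])

theorem sum_sq_cubeFourierCoeff (f : (Fin n → Bool) → ℝ) :
    ∑ S, cubeFourierCoeff f S ^ 2 = cubeMean fun x => f x ^ 2 := by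
  have h_sq (S : Finset (Fin n)) : cubeFourierCoeff f S ^ 2
      = (∑ x, ∑ y, f x * f y * (parity S x * parity S y)) / (2 ^ n * 2 ^ n) := by
    rw [cubeFourierCoeff, cubeMean, div_pow, sq, sum_mul_sum, sq]
    simp only [mul_mul_mul_comm]
  have h_orth (x : Fin n → Bool) :
      ∑ S, ∑ y, f x * f y * (parity S x * parity S y) = f x ^ 2 * 2 ^ n := by
    rw [sum_comm]
    simp_rw [← mul_sum, sum_parity_mul_parity]
    simp [sq]
  simp_rw [h_sq]
  rw [← sum_div, sum_comm]
  simp_rw [h_orth]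
  rw [← sum_mul, cubeMean]
  field_simp

theorem cubeL2Norm_sq (f : (Fin n → Bool) → ℝ) :
    cubeL2Norm f ^ 2 = cubeMean fun x => f x ^ 2 :=
  Real.sq_sqrt (div_nonneg (sum_nonneg fun _ _ => sq_nonneg _) (by positivity))

theorem cubeFourierCoeff_sub (f g : (Fin n → Bool) → ℝ) (S : Finset (Fin n)) :
    cubeFourierCoeff (fun x => f x - g x) S = cubeFourierCoeff f S - cubeFourierCoeff g S := by
  simp only [cubeFourierCoeff, cubeMean, sub_mul, sum_sub_distrib, sub_div]

theorem fourierWeight_nonneg (f : (Fin n → Bool) → ℝ) (j : ℕ) : 0 ≤ fourierWeight f j :=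
  sum_nonneg fun _ _ => sq_nonneg _

theorem fourierWeightAbove_eq_sum (f : (Fin n → Bool) → ℝ) (d : ℕ) :
    fourierWeightAbove f d = ∑ S with d < #S, cubeFourierCoeff f S ^ 2 := by
  have h_maps : ∀ S ∈ ({S | d < #S} : Finset (Finset (Fin n))), #S ∈ Ioc d n := fun S hS =>
    mem_Ioc.mpr ⟨(mem_filter.mp hS).2, card_finset_fin_le S⟩
  rw [fourierWeightAbove, ← sum_fiberwise_of_maps_to h_maps]
  refine sum_congr rfl fun j hj => sum_congr ?_ fun _ _ => rfl
  ext S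
  rw [mem_Ioc] at hj
  simp only [mem_powersetCard, subset_univ, true_and, mem_filter, mem_univ]
  omega

-- A monomial in fewer than `#S` variables misses some `i ∈ S`, and averages to `0` over that bit.
theorem cubeFourierCoeff_evalCube_of_totalDegree_lt {p : MvPolynomial (Fin n) ℝ}
    {S : Finset (Fin n)} (h : p.totalDegree < #S) : cubeFourierCoeff (evalCube p) S = 0 := by
  suffices ∀ α ∈ p.support,
      ∑ x : Fin n → Bool, (p.coeff α * ∏ i, ((x i).toNat : ℝ) ^ α i) * parity S x = 0 by
    simp only [cubeFourierCoeff, cubeMean, evalCube, MvPolynomial.eval_eq', sum_mul]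
    rw [sum_comm, sum_eq_zero this, zero_div]
  intro α hα
  have h_card : #α.support < #S := by
    refine lt_of_le_of_lt ?_ ((MvPolynomial.le_totalDegree hα).trans_lt h)
    rw [Finsupp.sum, card_eq_sum_ones]
    exact sum_le_sum fun i hi => Nat.one_le_iff_ne_zero.mpr (Finsupp.mem_support_iff.mp hi)
  obtain ⟨i, hiS, hiα⟩ := exists_mem_notMem_of_card_lt_card h_card
  simp only [parity_eq_prod, mul_assoc, ← mul_sum, ← prod_mul_distrib]
  rw [← Fintype.prod_sum fun i (b : Bool) =>
    (b.toNat : ℝ) ^ α i * if i ∈ S then (-1 : ℝ) ^ b.toNat else 1,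
    prod_eq_zero (mem_univ i), mul_zero]
  simp [hiS, Finsupp.notMem_support_iff.mp hiα]

theorem fourierWeightAbove_le_cubeL2Norm_sub_sq {p : MvPolynomial (Fin n) ℝ}
    (hp : p.totalDegree ≤ d) :
    fourierWeightAbove f d ≤ cubeL2Norm (fun x => f x - evalCube p x) ^ 2 :=
  calc fourierWeightAbove f d
      = ∑ S with d < #S, cubeFourierCoeff (fun x => f x - evalCube p x) S ^ 2 := by
        rw [fourierWeightAbove_eq_sum]
        refine sum_congr rfl fun S hS => ?_
        rw [cubeFourierCoeff_sub,
          cubeFourierCoeff_evalCube_of_totalDegree_lt (hp.trans_lt (mem_filter.mp hS).2), sub_zero]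
    _ ≤ ∑ S, cubeFourierCoeff (fun x => f x - evalCube p x) S ^ 2 :=
        sum_le_univ_sum_of_nonneg fun _ => sq_nonneg _
    _ = cubeL2Norm (fun x => f x - evalCube p x) ^ 2 := by
        rw [sum_sq_cubeFourierCoeff, cubeL2Norm_sq]

theorem evalCube_surjective : Function.Surjective (evalCube (n := n)) := by
  intro f
  refine ⟨∑ y, MvPolynomial.C (f y) *
    ∏ i, if y i then MvPolynomial.X i else 1 - MvPolynomial.X i, ?_⟩
  funext x
  simp only [evalCube, map_sum, map_mul, MvPolynomial.eval_C, map_prod]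
  rw [sum_eq_single_of_mem x (mem_univ x)]
  · rw [prod_eq_one, mul_one]
    intro i _
    cases hx : x i <;> simp [hx]
  · intro y _ hy
    obtain ⟨i, hi⟩ := Function.ne_iff.mp hy
    rw [prod_eq_zero (mem_univ i), mul_zero]
    cases hx : x i <;> cases hy : y i <;> simp_all

theorem exists_totalDegree_le_approxDegree (hε : 0 ≤ ε) (f : (Fin n → Bool) → ℝ) :
    ∃ p : MvPolynomial (Fin n) ℝ,
      p.totalDegree ≤ approxDegree ε f ∧ cubeL2Norm (fun x => f x - evalCube p x) ≤ ε := by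
  refine Nat.sInf_mem (s := {d | ∃ p : MvPolynomial (Fin n) ℝ, p.totalDegree ≤ d ∧
    cubeL2Norm (fun x => f x - evalCube p x) ≤ ε}) ?_
  obtain ⟨p, rfl⟩ := evalCube_surjective f
  exact ⟨p.totalDegree, p, le_rfl, by simpa [cubeL2Norm, cubeMean] using hε⟩

theorem lt_approxDegree_of_sq_lt_fourierWeightAbove (hε : 0 ≤ ε)
    (h : ε ^ 2 < fourierWeightAbove f d) : d < approxDegree ε f := by
  obtain ⟨p, hp, hpε⟩ := exists_totalDegree_le_approxDegree hε f
  by_contra! hd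
  refine h.not_ge ((fourierWeightAbove_le_cubeL2Norm_sub_sq (hp.trans hd)).trans ?_)
  exact pow_le_pow_left₀ (Real.sqrt_nonneg _) hpε 2

end Fourier

section HockeyStick

variable {n : ℕ}

theorem prefixWeight_mono (k : ℕ) : Monotone (prefixWeight (n := n) k) := fun _ _ h =>
  sum_le_sum fun i _ => Bool.toNat_le_toNat (h i)

theorem prefixWeight_sup_add_prefixWeight_inf (k : ℕ) (x y : Fin n → Bool) :
    prefixWeight k (x ⊔ y) + prefixWeight k (x ⊓ y) = prefixWeight k x + prefixWeight k y := by
  simp only [prefixWeight, ← sum_add_distrib, Pi.sup_apply, Pi.inf_apply]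
  refine sum_congr rfl fun i _ => ?_
  cases x i <;> cases y i <;> rfl

theorem prefixWeight_comp_perm {k : ℕ} {σ : Equiv.Perm (Fin n)}
    (hσ : ∀ i, (σ i).val < k ↔ i.val < k) (x : Fin n → Bool) :
    prefixWeight k (x ∘ σ) = prefixWeight k x :=
  sum_equiv σ (by simp [hσ]) fun _ _ => rfl

theorem Submodular.const_min {f : (Fin n → Bool) → ℝ} (hf : Submodular f) (hmono : Monotone f)
    (c : ℝ) : Submodular fun x => min c (f x) := by
  intro x y
  have hxy := hf x y
  have hx_inf : f (x ⊓ y) ≤ f x := hmono inf_le_left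
  have hy_inf : f (x ⊓ y) ≤ f y := hmono inf_le_right
  have hx_sup : f x ≤ f (x ⊔ y) := hmono le_sup_left
  have hy_sup : f y ≤ f (x ⊔ y) := hmono le_sup_right
  grind

theorem monotone_two_mul_prefixWeight_div (k : ℕ) :
    Monotone fun x : Fin n → Bool => 2 * (prefixWeight k x : ℝ) / k := fun x y h => by
  have := prefixWeight_mono k h
  dsimp only
  gcongr

theorem submodular_two_mul_prefixWeight_div (k : ℕ) :
    Submodular fun x : Fin n → Bool => 2 * (prefixWeight k x : ℝ) / k := fun x y => by
  have h : (prefixWeight k (x ⊔ y) + prefixWeight k (x ⊓ y) : ℝ)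
      = prefixWeight k x + prefixWeight k y := mod_cast prefixWeight_sup_add_prefixWeight_inf k x y
  rw [← add_div, ← mul_add, h, mul_add, add_div]

theorem hockeyStick_mem_Icc (k : ℕ) (x : Fin n → Bool) : hockeyStick n k x ∈ Set.Icc (0 : ℝ) 1 :=
  ⟨le_min zero_le_one (by positivity), min_le_left _ _⟩

theorem hockeyStick_monotone (k : ℕ) : Monotone (hockeyStick n k) :=
  monotone_const.min (monotone_two_mul_prefixWeight_div k)

theorem hockeyStick_submodular (k : ℕ) : Submodular (hockeyStick n k) :=
  (submodular_two_mul_prefixWeight_div k).const_min (monotone_two_mul_prefixWeight_div k) 1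

theorem hockeyStick_comp_perm {k : ℕ} {σ : Equiv.Perm (Fin n)}
    (hσ : ∀ i, (σ i).val < k ↔ i.val < k) (x : Fin n → Bool) :
    hockeyStick n k (x ∘ σ) = hockeyStick n k x := by
  rw [hockeyStick, prefixWeight_comp_perm hσ, hockeyStick]

end HockeyStick

section SuperCatalan

/-- The super Catalan number `(2r)! (2s)! / (r! s! (r+s)!)`. It is an integer, but only its real
value is needed, so the division is taken in `ℝ`. -/
noncomputable def superCatalan (r s : ℕ) : ℝ :=
  (2 * r)! * (2 * s)! / (r ! * s ! * (r + s)!)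

theorem cast_centralBinom_eq_div (r : ℕ) : (r.centralBinom : ℝ) = (2 * r)! / (r ! * r !) := by
  rw [Nat.centralBinom_eq_two_mul_choose, two_mul, Nat.cast_add_choose]

theorem superCatalan_zero_left (s : ℕ) : superCatalan 0 s = s.centralBinom := by
  simp [superCatalan, cast_centralBinom_eq_div]

theorem superCatalan_succ_left_add_succ_right (r s : ℕ) :
    superCatalan (r + 1) s + superCatalan r (s + 1) = 4 * superCatalan r s := by
  have h_double (m : ℕ) : ((2 * (m + 1))! : ℝ) = (2 * m + 2) * (2 * m + 1) * (2 * m)! := by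
    rw [mul_add_one, Nat.factorial_succ, Nat.factorial_succ]
    push_cast
    ring
  rw [superCatalan, superCatalan, superCatalan, h_double, h_double, add_right_comm r 1 s,
    ← add_assoc, Nat.factorial_succ, Nat.factorial_succ, Nat.factorial_succ]
  push_cast
  field_simp
  ring

-- Von Szily's identity; the recursion comes from `(1 - X)² = (1 + X)² - 4X`.
theorem coeff_one_sub_X_pow_mul_one_add_X_pow (r s : ℕ) :
    ((1 - X : ℝ[X]) ^ (2 * r) * (1 + X) ^ (2 * s)).coeff (r + s)
      = (-1) ^ r * superCatalan r s := by
  induction r generalizing s with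
  | zero =>
    simp [coeff_one_add_X_pow, superCatalan_zero_left, Nat.centralBinom_eq_two_mul_choose]
  | succ r ih =>
    have h_split : (1 - X : ℝ[X]) ^ (2 * (r + 1)) * (1 + X) ^ (2 * s)
        = (1 - X) ^ (2 * r) * (1 + X) ^ (2 * (s + 1))
          - C 4 * (X * ((1 - X) ^ (2 * r) * (1 + X) ^ (2 * s))) := by
      rw [C_ofNat]
      ring
    rw [h_split, coeff_sub, coeff_C_mul, add_right_comm, coeff_X_mul, add_assoc r s 1, ih, ih,
      pow_succ]
    linear_combination (-1 : ℝ) ^ r * superCatalan_succ_left_add_succ_right r s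

theorem choose_mul_superCatalan_sq (r s : ℕ) :
    ((2 * (r + s)).choose (2 * r) : ℝ) * superCatalan r s ^ 2
      = r.centralBinom * s.centralBinom * (r + s).centralBinom := by
  rw [superCatalan, cast_centralBinom_eq_div, cast_centralBinom_eq_div, cast_centralBinom_eq_div,
    mul_add 2 r s, Nat.cast_add_choose]
  field_simp

theorem sixteen_pow_le_mul_centralBinom_sq (r : ℕ) :
    16 ^ r ≤ (4 * r + 1) * r.centralBinom ^ 2 := by
  induction r with
  | zero => simp
  | succ r ih =>
    have h_rec := r.succ_mul_centralBinom_succ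
    refine le_of_mul_le_mul_left ?_ (pow_pos r.succ_pos 2)
    calc (r + 1) ^ 2 * 16 ^ (r + 1)
        = 16 * (r + 1) ^ 2 * 16 ^ r := by ring
      _ ≤ 16 * (r + 1) ^ 2 * ((4 * r + 1) * r.centralBinom ^ 2) := by gcongr
      _ = (16 * (r + 1) ^ 2 * (4 * r + 1)) * r.centralBinom ^ 2 := by ring
      _ ≤ ((4 * (r + 1) + 1) * (2 * (2 * r + 1)) ^ 2) * r.centralBinom ^ 2 := by
        refine Nat.mul_le_mul_right _ ?_
        nlinarith
      _ = (4 * (r + 1) + 1) * (2 * (2 * r + 1) * r.centralBinom) ^ 2 := by ring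
      _ = (r + 1) ^ 2 * ((4 * (r + 1) + 1) * (r + 1).centralBinom ^ 2) := by
        rw [← h_rec]
        ring

theorem rpow_le_centralBinom_div_four_pow (r : ℕ) :
    (r + 1 : ℝ) ^ (-(1 / 2) : ℝ) / 2 ≤ r.centralBinom / 4 ^ r := by
  have h : (16 : ℝ) ^ r ≤ (4 * r + 1) * r.centralBinom ^ 2 :=
    mod_cast sixteen_pow_le_mul_centralBinom_sq r
  refine le_of_sq_le_sq ?_ (by positivity)
  rw [div_pow, div_pow, ← pow_mul, mul_comm r, pow_mul, ← Real.rpow_mul_natCast (by positivity)]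
  norm_num
  rw [Real.rpow_neg_one, div_le_div_iff₀ (by positivity) (by positivity),
    inv_mul_le_iff₀ (by positivity)]
  nlinarith [sq_nonneg (r.centralBinom : ℝ)]

theorem rpow_div_le_choose_mul_superCatalan_sq (r s : ℕ) :
    (r + 1 : ℝ) ^ (-(1 / 2) : ℝ) / (8 * (r + s + 1))
      ≤ (2 * (r + s)).choose (2 * r) * (superCatalan r s / 4 ^ (r + s)) ^ 2 := by
  have hr := rpow_le_centralBinom_div_four_pow r
  have hs : (r + s + 1 : ℝ) ^ (-(1 / 2) : ℝ) / 2 ≤ s.centralBinom / 4 ^ s :=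
    le_trans (div_le_div_of_nonneg_right (Real.rpow_le_rpow_of_nonpos (by positivity)
      (by linarith [r.cast_nonneg (α := ℝ)]) (by norm_num)) zero_le_two)
      (rpow_le_centralBinom_div_four_pow s)
  have hrs : (r + s + 1 : ℝ) ^ (-(1 / 2) : ℝ) / 2 ≤ (r + s).centralBinom / 4 ^ (r + s) :=
    mod_cast rpow_le_centralBinom_div_four_pow (r + s)
  have h_inv : (r + s + 1 : ℝ) ^ (-(1 / 2) : ℝ) * (r + s + 1 : ℝ) ^ (-(1 / 2) : ℝ)
      = (r + s + 1 : ℝ)⁻¹ := by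
    rw [← Real.rpow_add (by positivity), ← Real.rpow_neg_one]
    norm_num
  calc (r + 1 : ℝ) ^ (-(1 / 2) : ℝ) / (8 * (r + s + 1))
      = (r + 1 : ℝ) ^ (-(1 / 2) : ℝ) / 2 * ((r + s + 1 : ℝ) ^ (-(1 / 2) : ℝ) / 2 *
          ((r + s + 1 : ℝ) ^ (-(1 / 2) : ℝ) / 2)) := by
        rw [div_mul_div_comm (_ ^ _) 2 (_ ^ _) 2, h_inv]
        field_simp
        norm_num
    _ ≤ r.centralBinom / 4 ^ r * (s.centralBinom / 4 ^ s *
          ((r + s).centralBinom / 4 ^ (r + s))) := by gcongr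
    _ = (2 * (r + s)).choose (2 * r) * (superCatalan r s / 4 ^ (r + s)) ^ 2 := by
        rw [div_pow (superCatalan r s), ← mul_div_assoc (_ : ℝ) (superCatalan r s ^ 2),
          choose_mul_superCatalan_sq, pow_add]
        field_simp

theorem choose_succ_le_four_mul_choose {m j : ℕ} (h : 4 * j ≤ 3 * (m + 1)) :
    (m + 1).choose j ≤ 4 * m.choose j := by
  have h_rec := Nat.choose_mul_succ_eq m j
  refine le_of_mul_le_mul_right ?_ m.succ_pos
  calc (m + 1).choose j * (m + 1) ≤ (m + 1).choose j * (4 * (m + 1 - j)) := by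
        gcongr
        omega
    _ = 4 * m.choose j * (m + 1) := by
        rw [mul_assoc, h_rec]
        ring

theorem choose_add_two_mul (m j : ℕ) :
    (m + 2).choose (j + 2) * ((j + 2) * (j + 1)) = (m + 2) * (m + 1) * m.choose j := by
  rw [← mul_assoc, ← Nat.add_one_mul_choose_eq (m + 1) (j + 1), mul_assoc,
    ← Nat.add_one_mul_choose_eq m j, mul_assoc]

theorem mul_choose_le_mul_choose_add_two {k r s : ℕ} (hk : (k + 1) / 2 = r + s + 1) (hk2 : 2 ≤ k)
    (hr : 8 * r + 2 ≤ 3 * k) :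
    k * (r + s + 1) * (2 * (r + s)).choose (2 * r)
      ≤ 16 * (r + 1) ^ 2 * k.choose (2 * r + 2) := by
  obtain ⟨m, rfl⟩ := Nat.exists_eq_add_of_le' hk2
  have h_choose : (2 * (r + s)).choose (2 * r) ≤ 4 * m.choose (2 * r) := by
    obtain hm | hm : 2 * (r + s) = m ∨ 2 * (r + s) = m + 1 := by omega
    · rw [hm]
      omega
    · rw [hm]
      exact choose_succ_le_four_mul_choose (by omega)
  calc (m + 2) * (r + s + 1) * (2 * (r + s)).choose (2 * r)
      ≤ (m + 2) * (m + 1) * (4 * m.choose (2 * r)) := by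
        rw [mul_assoc, mul_assoc]
        exact Nat.mul_le_mul_left _ (Nat.mul_le_mul (by omega) h_choose)
    _ = 4 * ((2 * r + 2) * (2 * r + 1)) * (m + 2).choose (2 * r + 2) := by
        linarith [choose_add_two_mul m (2 * r)]
    _ ≤ 16 * (r + 1) ^ 2 * (m + 2).choose (2 * r + 2) := by
        refine Nat.mul_le_mul_right _ ?_
        nlinarith

end SuperCatalan

section SymmetricFunctions

section Pairing

/-- The pairing `⟨g, p⟩ = ∑ w, g w * p_w` of a sequence `g` with the coefficients `p_w` of a
polynomial `p`, linear in both arguments. It converts sums over the cube of a function of the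
Hamming weight into coefficients of generating functions. -/
noncomputable def coeffPairing (R : Type*) [CommSemiring R] : (ℕ → R) ≃ₗ[R] R[X] →ₗ[R] R :=
  (basisMonomials R).constr R

variable {R : Type*}

theorem coeffPairing_monomial [CommSemiring R] (g : ℕ → R) (w : ℕ) (a : R) :
    coeffPairing R g (monomial w a) = a * g w := by
  have h : coeffPairing R g (monomial w 1) = g w := by
    simpa only [coeffPairing, coe_basisMonomials] using (basisMonomials R).constr_basis R g w
  rw [← h, ← smul_eq_mul, ← map_smul, smul_monomial, smul_eq_mul, mul_one]

theorem coeffPairing_C_mul_X_pow [CommSemiring R] (g : ℕ → R) (a : R) (w : ℕ) :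
    coeffPairing R g (C a * X ^ w) = a * g w := by
  rw [C_mul_X_pow_eq_monomial, coeffPairing_monomial]

theorem coeffPairing_single [CommSemiring R] (w : ℕ) (a : R) (p : R[X]) :
    coeffPairing R (Pi.single w a) p = a * p.coeff w := by
  induction p using Polynomial.induction_on' with
  | add p q hp hq => rw [map_add, hp, hq, coeff_add, mul_add]
  | monomial v b =>
    rw [coeffPairing_monomial, coeff_monomial, Pi.single_apply, mul_comm, ite_mul, mul_ite,
      zero_mul, mul_zero]

theorem coeffPairing_X_sub_one_mul [CommRing R] (g : ℕ → R) (p : R[X]) :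
    coeffPairing R g ((X - 1) * p) = coeffPairing R (Δ_[1] g) p := by
  induction p using Polynomial.induction_on' with
  | add p q hp hq => rw [mul_add, map_add, map_add, hp, hq]
  | monomial w a =>
    rw [sub_mul, one_mul, X_mul_monomial, map_sub, coeffPairing_monomial, coeffPairing_monomial,
      coeffPairing_monomial, fwdDiff, mul_sub]

theorem coeffPairing_X_sub_one_pow_mul [CommRing R] (g : ℕ → R) (j : ℕ) (p : R[X]) :
    coeffPairing R g ((X - 1) ^ j * p) = coeffPairing R ((fwdDiff 1)^[j] g) p := by
  induction j generalizing g with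
  | zero => simp
  | succ j ih =>
    rw [pow_succ', mul_assoc, coeffPairing_X_sub_one_mul, ih, Function.iterate_succ_apply]

end Pairing

/-- The Fourier coefficient on a set of size `j` of the symmetric function of `k` bits whose value
at Hamming weight `w` is `g w`. -/
noncomputable def symmetricFourierCoeff (k : ℕ) (g : ℕ → ℝ) (j : ℕ) : ℝ :=
  coeffPairing ℝ g ((1 - X) ^ j * (1 + X) ^ (k - j)) / 2 ^ k

variable {n : ℕ} {A S : Finset (Fin n)}

theorem sum_C_parity_mul_X_pow (hSA : S ⊆ A) :
    ∑ x : Fin n → Bool, (C (parity S x) * X ^ (∑ i ∈ A, (x i).toNat) : ℝ[X])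
      = C (2 ^ (n - #A)) * ((1 - X) ^ #S * (1 + X) ^ (#A - #S)) := by
  have h_term (x : Fin n → Bool) : (C (parity S x) * X ^ (∑ i ∈ A, (x i).toNat) : ℝ[X])
      = ∏ i, (C (if i ∈ S then (-1 : ℝ) ^ (x i).toNat else 1) *
          if i ∈ A then X ^ (x i).toNat else 1) := by
    rw [prod_mul_distrib, ← map_prod, ← parity_eq_prod, prod_ite_mem, univ_inter,
      prod_pow_eq_pow_sum]
  have h_factor (i : Fin n) : ∑ b : Bool, (C (if i ∈ S then (-1 : ℝ) ^ b.toNat else 1) *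
        if i ∈ A then X ^ b.toNat else 1 : ℝ[X])
      = (if i ∈ Aᶜ then C 2 else 1) *
          ((if i ∈ S then 1 - X else 1) * if i ∈ A \ S then 1 + X else 1) := by
    by_cases hA : i ∈ A
    · by_cases hS : i ∈ S
      · simp [hA, hS, sub_eq_neg_add]
      · simp [hA, hS, add_comm]
    · simp [hA, mt (@hSA i) hA, one_add_one_eq_two, ← C_ofNat]
  simp_rw [h_term]
  rw [← Fintype.prod_sum fun i (b : Bool) => (C (if i ∈ S then (-1 : ℝ) ^ b.toNat else 1) *
    if i ∈ A then X ^ b.toNat else 1 : ℝ[X])]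
  simp_rw [h_factor, prod_mul_distrib, prod_ite_mem, univ_inter, prod_const]
  rw [card_compl, Fintype.card_fin, card_sdiff_of_subset hSA, C_pow]

theorem cubeFourierCoeff_symmetric (g : ℕ → ℝ) (hSA : S ⊆ A) :
    cubeFourierCoeff (fun x => g (∑ i ∈ A, (x i).toNat)) S = symmetricFourierCoeff #A g #S := by
  have h_sum : ∑ x : Fin n → Bool, g (∑ i ∈ A, (x i).toNat) * parity S x
      = 2 ^ (n - #A) * coeffPairing ℝ g ((1 - X) ^ #S * (1 + X) ^ (#A - #S)) := by
    rw [← smul_eq_mul, ← map_smul, smul_eq_C_mul, ← sum_C_parity_mul_X_pow hSA, map_sum]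
    simp only [coeffPairing_C_mul_X_pow, mul_comm]
  have h_pow : (2 : ℝ) ^ n = 2 ^ (n - #A) * 2 ^ #A := by
    rw [← pow_add, Nat.sub_add_cancel (card_finset_fin_le A)]
  rw [cubeFourierCoeff, cubeMean, h_sum, symmetricFourierCoeff, h_pow,
    mul_div_mul_left _ _ (by positivity)]

theorem choose_mul_symmetricFourierCoeff_sq_le_fourierWeight (g : ℕ → ℝ) (A : Finset (Fin n))
    (j : ℕ) : (#A).choose j * symmetricFourierCoeff #A g j ^ 2
      ≤ fourierWeight (fun x => g (∑ i ∈ A, (x i).toNat)) j :=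
  calc (#A).choose j * symmetricFourierCoeff #A g j ^ 2
      = ∑ S ∈ powersetCard j A, cubeFourierCoeff (fun x => g (∑ i ∈ A, (x i).toNat)) S ^ 2 := by
        rw [← nsmul_eq_mul, ← card_powersetCard, ← sum_const]
        refine sum_congr rfl fun S hS => ?_
        obtain ⟨hSA, rfl⟩ := mem_powersetCard.mp hS
        rw [cubeFourierCoeff_symmetric g hSA]
    _ ≤ fourierWeight (fun x => g (∑ i ∈ A, (x i).toNat)) j :=
        sum_le_sum_of_subset_of_nonneg (powersetCard_mono (subset_univ A)) fun _ _ _ => sq_nonneg _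

end SymmetricFunctions

section HockeyStickSpectrum

variable {n k r s d : ℕ}

/-- The value of `hs_k` at the points whose first `k` bits have Hamming weight `w`. -/
noncomputable def hockeyStickProfile (k w : ℕ) : ℝ :=
  min 1 (2 * (w : ℝ) / k)

theorem choose_mul_sq_le_fourierWeight_hockeyStick (hkn : k ≤ n) (j : ℕ) :
    k.choose j * symmetricFourierCoeff k (hockeyStickProfile k) j ^ 2
      ≤ fourierWeight (hockeyStick n k) j := by
  have h_card : #{i : Fin n | i.val < k} = k := by rw [Fin.card_filter_val_lt, min_eq_right hkn]
  have h := choose_mul_symmetricFourierCoeff_sq_le_fourierWeight (hockeyStickProfile k)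
    {i : Fin n | i.val < k} j
  rwa [h_card] at h

theorem fwdDiff_iter_two_min_succ (m : ℕ) :
    (fwdDiff 1)^[2] (fun w : ℕ => ((min (m + 1) w : ℕ) : ℝ)) = -Pi.single m 1 := by
  funext w
  simp only [Function.iterate_succ, Function.iterate_zero, Function.comp_apply, id, fwdDiff,
    Pi.neg_apply, Pi.single_apply]
  obtain hw | rfl | hw := lt_trichotomy w m
  · rw [min_eq_right (by omega), min_eq_right (by omega), min_eq_right (by omega), if_neg hw.ne]
    push_cast
    ring
  · rw [min_eq_left (by omega), min_eq_right (by omega), min_eq_right (by omega), if_pos rfl]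
    push_cast
    ring
  · rw [min_eq_left (by omega), min_eq_left (by omega), min_eq_left (by omega), if_neg hw.ne']
    ring

-- Splitting the kink into two treats even and odd `k` alike.
theorem hockeyStickProfile_eq_smul_add (hk : k ≠ 0) :
    hockeyStickProfile k = (k : ℝ)⁻¹ • ((fun w : ℕ => ((min (k / 2) w : ℕ) : ℝ)) +
      fun w : ℕ => ((min ((k + 1) / 2) w : ℕ) : ℝ)) := by
  have hk0 : (0 : ℝ) < k := by positivity
  funext w
  have h_min : ((min k (2 * w) : ℕ) : ℝ) = (min (k / 2) w : ℕ) + (min ((k + 1) / 2) w : ℕ) :=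
    mod_cast (by omega : min k (2 * w) = min (k / 2) w + min ((k + 1) / 2) w)
  rw [hockeyStickProfile, Pi.smul_apply, Pi.add_apply, ← h_min, smul_eq_mul, Nat.cast_min,
    mul_min_of_nonneg _ _ (inv_nonneg.mpr hk0.le), inv_mul_cancel₀ hk0.ne', inv_mul_eq_div]
  push_cast
  rfl

theorem fwdDiff_iter_two_hockeyStickProfile (hk : 2 ≤ k) :
    (fwdDiff 1)^[2] (hockeyStickProfile k)
      = -(k : ℝ)⁻¹ • (Pi.single (k / 2 - 1) 1 + Pi.single ((k + 1) / 2 - 1) 1) := by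
  have h_kink {m : ℕ} (hm : 1 ≤ m) :
      (fwdDiff 1)^[2] (fun w : ℕ => ((min m w : ℕ) : ℝ)) = -Pi.single (m - 1) 1 := by
    conv_lhs => rw [← Nat.sub_add_cancel hm]
    exact fwdDiff_iter_two_min_succ (m - 1)
  rw [hockeyStickProfile_eq_smul_add (by omega), fwdDiff_iter_const_smul, fwdDiff_iter_add,
    h_kink (by omega), h_kink (by omega), ← neg_add, smul_neg, neg_smul]

theorem four_pow_mul_coeff_add_coeff (hk : (k + 1) / 2 = r + s + 1) (hrk : 2 * r + 2 ≤ k) :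
    2 * 4 ^ (r + s) *
        (((1 - X : ℝ[X]) ^ (2 * r) * (1 + X) ^ (k - (2 * r + 2))).coeff (k / 2 - 1) +
          ((1 - X : ℝ[X]) ^ (2 * r) * (1 + X) ^ (k - (2 * r + 2))).coeff ((k + 1) / 2 - 1))
      = 2 ^ k * ((-1) ^ r * superCatalan r s) := by
  have h_coeff := coeff_one_sub_X_pow_mul_one_add_X_pow r s
  have h_four : (4 : ℝ) ^ (r + s) = 2 ^ (2 * (r + s)) := by rw [pow_mul]; norm_num
  obtain h_even | h_odd : k = 2 * (r + s) + 2 ∨ k = 2 * (r + s) + 1 := by omega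
  · rw [show k / 2 - 1 = r + s by omega, show (k + 1) / 2 - 1 = r + s by omega,
      show k - (2 * r + 2) = 2 * s by omega, h_coeff, h_four, h_even, pow_add]
    ring
  · obtain ⟨t, rfl⟩ : ∃ t, s = t + 1 := ⟨s - 1, by omega⟩
    have h_factor : ((1 - X) ^ (2 * r) * (1 + X) ^ (2 * (t + 1)) : ℝ[X])
        = X * ((1 - X) ^ (2 * r) * (1 + X) ^ (2 * t + 1))
          + (1 - X) ^ (2 * r) * (1 + X) ^ (2 * t + 1) := by ring
    rw [h_factor, ← add_assoc, coeff_add, coeff_X_mul] at h_coeff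
    rw [show k / 2 - 1 = r + t by omega, show (k + 1) / 2 - 1 = r + t + 1 by omega,
      show k - (2 * r + 2) = 2 * t + 1 by omega, h_coeff, h_four, h_odd, pow_succ]
    ring

theorem symmetricFourierCoeff_hockeyStickProfile (hk : (k + 1) / 2 = r + s + 1)
    (hrk : 2 * r + 2 ≤ k) :
    symmetricFourierCoeff k (hockeyStickProfile k) (2 * r + 2)
      = -((-1) ^ r * (superCatalan r s / 4 ^ (r + s))) / (2 * k) := by
  have hk0 : (k : ℝ) ≠ 0 := by norm_cast; omega
  have h_coeff := four_pow_mul_coeff_add_coeff hk hrk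
  have h_sq : ((1 - X) ^ (2 * r + 2) * (1 + X) ^ (k - (2 * r + 2)) : ℝ[X])
      = (X - 1) ^ 2 * ((1 - X) ^ (2 * r) * (1 + X) ^ (k - (2 * r + 2))) := by ring
  rw [symmetricFourierCoeff, h_sq, coeffPairing_X_sub_one_pow_mul,
    fwdDiff_iter_two_hockeyStickProfile (by omega), map_smul, map_add, LinearMap.smul_apply,
    LinearMap.add_apply, coeffPairing_single, coeffPairing_single, smul_eq_mul, one_mul, one_mul]
  field_simp
  linear_combination -h_coeff

theorem rpow_le_fourierWeight_hockeyStick (hkn : k ≤ n) (hk : 2 ≤ k) (hr : 8 * r + 2 ≤ 3 * k) :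
    1 / 512 * ((r + 1 : ℝ) ^ (-(5 / 2) : ℝ) / k) ≤ fourierWeight (hockeyStick n k) (2 * r + 2) := by
  obtain ⟨s, hs⟩ : ∃ s, (k + 1) / 2 = r + s + 1 := ⟨(k + 1) / 2 - (r + 1), by omega⟩
  have h_choose : (k * (r + s + 1) * (2 * (r + s)).choose (2 * r) : ℝ)
      ≤ 16 * (r + 1) ^ 2 * k.choose (2 * r + 2) :=
    mod_cast mul_choose_le_mul_choose_add_two hs hk hr
  have h_rpow : (r + 1 : ℝ) ^ (-(5 / 2) : ℝ) = (r + 1 : ℝ) ^ (-(1 / 2) : ℝ) / (r + 1) ^ 2 := by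
    rw [← Real.rpow_sub_natCast (by positivity)]
    norm_num
  set σ : ℝ := superCatalan r s / 4 ^ (r + s) with hσ
  have h_sq : symmetricFourierCoeff k (hockeyStickProfile k) (2 * r + 2) ^ 2
      = σ ^ 2 / (4 * k ^ 2) := by
    rw [symmetricFourierCoeff_hockeyStickProfile hs (by omega), ← hσ, div_pow, neg_sq, mul_pow,
      pow_right_comm, neg_one_sq, one_pow, one_mul, mul_pow]
    norm_num
  calc 1 / 512 * ((r + 1 : ℝ) ^ (-(5 / 2) : ℝ) / k)
      = k * (r + s + 1) / (16 * (r + 1) ^ 2) *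
          ((r + 1 : ℝ) ^ (-(1 / 2) : ℝ) / (8 * (r + s + 1))) / (4 * k ^ 2) := by
        rw [h_rpow]
        field_simp
        norm_num
    _ ≤ k * (r + s + 1) / (16 * (r + 1) ^ 2) *
          ((2 * (r + s)).choose (2 * r) * σ ^ 2) / (4 * k ^ 2) := by
        gcongr
        exact rpow_div_le_choose_mul_superCatalan_sq r s
    _ = (k * (r + s + 1) * (2 * (r + s)).choose (2 * r)) / (16 * (r + 1) ^ 2) *
          (σ ^ 2 / (4 * k ^ 2)) := by ring
    _ ≤ k.choose (2 * r + 2) * (σ ^ 2 / (4 * k ^ 2)) := by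
        gcongr
        exact div_le_of_le_mul₀ (by positivity) (by positivity) (by linarith)
    _ ≤ fourierWeight (hockeyStick n k) (2 * r + 2) :=
        h_sq ▸ choose_mul_sq_le_fourierWeight_hockeyStick hkn _

theorem rpow_le_fourierWeightAbove_hockeyStick (hkn : k ≤ n) (hd1 : 1 ≤ d) (hd : 2 * d ≤ k) :
    1 / 2048 * ((d : ℝ) ^ (-(3 / 2) : ℝ) / k) ≤ fourierWeightAbove (hockeyStick n k) d := by
  have hd0 : (0 : ℝ) < d := by positivity
  -- At least `d / 4` even levels `2r + 2` satisfy `d < 2r + 2` and `4r + 1 ≤ 3d`.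
  set R := Ico (d / 2) (d / 2 + (d + 3) / 4) with hR
  have h_card : (d : ℝ) / 4 ≤ #R := by
    rw [hR, Nat.card_Ico, Nat.add_sub_cancel_left, div_le_iff₀ four_pos]
    exact_mod_cast (by omega : d ≤ (d + 3) / 4 * 4)
  have h_level : ∀ r ∈ R, 1 / 512 * ((d : ℝ) ^ (-(5 / 2) : ℝ) / k)
      ≤ fourierWeight (hockeyStick n k) (2 * r + 2) := fun r hr => by
    rw [hR, mem_Ico] at hr
    have hrd : (r + 1 : ℝ) ≤ d := mod_cast (by omega : r + 1 ≤ d)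
    refine le_trans ?_ (rpow_le_fourierWeight_hockeyStick hkn (by omega) (by omega))
    gcongr ?_ * (?_ / _)
    exact Real.rpow_le_rpow_of_nonpos (by positivity) hrd (by norm_num)
  have h_rpow : (d : ℝ) ^ (-(3 / 2) : ℝ) = d * (d : ℝ) ^ (-(5 / 2) : ℝ) := by
    rw [← Real.rpow_one_add' hd0.le (by norm_num)]
    norm_num
  calc 1 / 2048 * ((d : ℝ) ^ (-(3 / 2) : ℝ) / k)
      = d / 4 * (1 / 512 * ((d : ℝ) ^ (-(5 / 2) : ℝ) / k)) := by
        rw [h_rpow]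
        ring
    _ ≤ #R * (1 / 512 * ((d : ℝ) ^ (-(5 / 2) : ℝ) / k)) := by gcongr
    _ ≤ ∑ r ∈ R, fourierWeight (hockeyStick n k) (2 * r + 2) := by
        rw [← nsmul_eq_mul]
        exact card_nsmul_le_sum _ _ _ h_level
    _ = ∑ j ∈ R.image (2 * · + 2), fourierWeight (hockeyStick n k) j :=
        (sum_image fun _ _ _ _ h => by simpa using h).symm
    _ ≤ fourierWeightAbove (hockeyStick n k) d := by
        refine sum_le_sum_of_subset_of_nonneg (image_subset_iff.mpr fun r hr => ?_)
          fun _ _ _ => fourierWeight_nonneg _ _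
        rw [hR, mem_Ico] at hr
        rw [mem_Ioc]
        omega

theorem fourierWeightAbove_zero_hockeyStick_one (hn : 1 ≤ n) :
    1 / 4 ≤ fourierWeightAbove (hockeyStick n 1) 0 := by
  have h_coeff : symmetricFourierCoeff 1 (hockeyStickProfile 1) 1 = -1 / 2 := by
    have h_poly : ((1 - X) ^ 1 * (1 + X) ^ (1 - 1) : ℝ[X]) = monomial 0 1 - monomial 1 1 := by
      rw [monomial_zero_one, monomial_one_one_eq_X]
      simp
    rw [symmetricFourierCoeff, h_poly, map_sub, coeffPairing_monomial, coeffPairing_monomial]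
    norm_num [hockeyStickProfile]
  calc (1 / 4 : ℝ)
      = (1 : ℕ).choose 1 * symmetricFourierCoeff 1 (hockeyStickProfile 1) 1 ^ 2 := by
        rw [h_coeff]
        norm_num
    _ ≤ fourierWeight (hockeyStick n 1) 1 := choose_mul_sq_le_fourierWeight_hockeyStick hn 1
    _ ≤ fourierWeightAbove (hockeyStick n 1) 0 :=
        single_le_sum (f := fourierWeight (hockeyStick n 1)) (fun _ _ => fourierWeight_nonneg _ _)
          (mem_Ioc.mpr ⟨one_pos, hn⟩)

theorem rpow_le_fourierWeightAbove_half_hockeyStick (hk : 1 ≤ k) (hkn : k ≤ n) :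
    1 / 2048 * (k : ℝ) ^ (-(5 / 2) : ℝ) ≤ fourierWeightAbove (hockeyStick n k) (k / 2) := by
  obtain rfl | hk2 := hk.eq_or_lt
  · exact le_trans (by norm_num) (fourierWeightAbove_zero_hockeyStick_one hkn)
  have hd0 : (0 : ℝ) < (k / 2 : ℕ) := Nat.cast_pos.mpr (by omega)
  have hdk : ((k / 2 : ℕ) : ℝ) ≤ k := Nat.cast_le.mpr (Nat.div_le_self k 2)
  have hk0 : (0 : ℝ) < k := hd0.trans_le hdk
  calc 1 / 2048 * (k : ℝ) ^ (-(5 / 2) : ℝ)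
      = 1 / 2048 * ((k : ℝ) ^ (-(3 / 2) : ℝ) / k) := by
        rw [← Real.rpow_sub_one hk0.ne']
        norm_num
    _ ≤ 1 / 2048 * (((k / 2 : ℕ) : ℝ) ^ (-(3 / 2) : ℝ) / k) := by
        gcongr 1 / 2048 * (?_ / _)
        exact Real.rpow_le_rpow_of_nonpos hd0 hdk (by norm_num)
    _ ≤ fourierWeightAbove (hockeyStick n k) (k / 2) :=
        rpow_le_fourierWeightAbove_hockeyStick hkn (by omega) (by omega)

theorem sq_lt_rpow_of_le_rpow {ε x : ℝ} (hε : 0 < ε) (hx : 0 < x)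
    (h : x ≤ 1 / 64 * ε ^ (-(4 / 5) : ℝ)) : ε ^ 2 < 1 / 2048 * x ^ (-(5 / 2) : ℝ) := by
  have h_const : (1 / 64 : ℝ) ^ (-(5 / 2) : ℝ) = 32768 := by
    rw [show (1 / 64 : ℝ) = 2 ^ (-6 : ℝ) by norm_num, ← Real.rpow_mul zero_le_two]
    norm_num
  have h_pow : (ε ^ (-(4 / 5) : ℝ)) ^ (-(5 / 2) : ℝ) = ε ^ 2 := by
    rw [← Real.rpow_mul hε.le]
    norm_num
  calc ε ^ 2 < 1 / 2048 * (32768 * ε ^ 2) := by linarith [pow_pos hε 2]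
    _ = 1 / 2048 * (1 / 64 * ε ^ (-(4 / 5) : ℝ)) ^ (-(5 / 2) : ℝ) := by
        rw [Real.mul_rpow (by norm_num) (by positivity), h_const, h_pow]
    _ ≤ 1 / 2048 * x ^ (-(5 / 2) : ℝ) := by
        gcongr 1 / 2048 * ?_
        exact Real.rpow_le_rpow_of_nonpos hx h (by norm_num)

end HockeyStickSpectrum


theorem mainTheorem3 :
    -- the spectral lower bound
    (∃ c : ℝ, 0 < c ∧ ∀ n k d : ℕ, k ≤ n → 1 ≤ d → (d : ℝ) ≤ (k : ℝ) / 2 →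
      c * ((d : ℝ) ^ (-(3 / 2) : ℝ) / (k : ℝ)) ≤ fourierWeightAbove (hockeyStick n k) d) ∧
    -- the choice `k = c₁ ε^{-4/5}`, and the resulting lower bound on the approximate degree
    (∃ c₁ c₂ : ℝ, 0 < c₁ ∧ 0 < c₂ ∧ ∀ (ε : ℝ) (n k : ℕ), 0 < ε →
      k = ⌊c₁ * ε ^ (-(4 / 5) : ℝ)⌋₊ → 1 ≤ k → k ≤ n →
        ε ^ 2 ≤ fourierWeightAbove (hockeyStick n k) (k / 2) ∧
        c₂ * ε ^ (-(4 / 5) : ℝ) ≤ (approxDegree ε (hockeyStick n k) : ℝ)) ∧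
    -- `hs_k` is `[0,1]`-valued, monotone, submodular, and symmetric in its `k` variables
    (∀ n k : ℕ, 1 ≤ k → k ≤ n →
      (∀ x, hockeyStick n k x ∈ Set.Icc (0 : ℝ) 1) ∧
      Monotone (hockeyStick n k) ∧
      Submodular (hockeyStick n k) ∧
      (∀ σ : Equiv.Perm (Fin n), (∀ i, (σ i).val < k ↔ i.val < k) →
        ∀ x, hockeyStick n k (x ∘ σ) = hockeyStick n k x)) := by
  refine ⟨⟨1 / 2048, by norm_num, fun n k d hkn hd1 hd => ?_⟩,
    ⟨1 / 64, 1 / 128, by norm_num, by norm_num, fun ε n k hε hk hk1 hkn => ?_⟩,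
    fun n k _ _ => ⟨hockeyStick_mem_Icc k, hockeyStick_monotone k, hockeyStick_submodular k,
      fun σ hσ => hockeyStick_comp_perm hσ⟩⟩
  · have hd2 : 2 * d ≤ k := by
      rify
      linarith
    exact rpow_le_fourierWeightAbove_hockeyStick hkn hd1 hd2
  · have h_le : (k : ℝ) ≤ 1 / 64 * ε ^ (-(4 / 5) : ℝ) := hk ▸ Nat.floor_le (by positivity)
    have h_lt : 1 / 64 * ε ^ (-(4 / 5) : ℝ) < k + 1 := hk ▸ Nat.lt_floor_add_one _
    have h_weight : ε ^ 2 < fourierWeightAbove (hockeyStick n k) (k / 2) :=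
      (sq_lt_rpow_of_le_rpow hε (Nat.cast_pos.mpr hk1) h_le).trans_le
        (rpow_le_fourierWeightAbove_half_hockeyStick hk1 hkn)
    have h_deg : k / 2 < approxDegree ε (hockeyStick n k) :=
      lt_approxDegree_of_sq_lt_fourierWeightAbove hε.le h_weight
    have h_deg' : (k + 1 : ℝ) ≤ 2 * approxDegree ε (hockeyStick n k) :=
      mod_cast (by omega : k + 1 ≤ 2 * approxDegree ε (hockeyStick n k))
    exact ⟨h_weight.le, by linarith⟩
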